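/- Let $R$ be an associative ring with $1$ that is semiprime (it has no nonzero two-sided ideal of square zero) and left Goldie (it contains no infinite direct sum of nonzero left ideals and satisfies the ascending chain condition on left annihilators of subsets). Let $X$ be a nonempty set of noncommuting variables, and for each $x \in X$ let $\sigma_x$ be a ring automorphism of $R$ and $\delta_x : R \to R$ a $\sigma_x$-derivation, i.e. an additive map with $\delta_x(ab) = \delta_x(a)b + \sigma_x(a)\delta_x(b)$ for all $a, b \in R$. Let $S = R[X; \mathscr{G}, \mathscr{D}]$, where $\mathscr{G} = \{\sigma_x\}_{x\in X}$ and $\mathscr{D} = \{\delta_x\}_{x\in X}$, be the free skew extension of $R$: a ring that contains $R$ as a subring and contains $X$, that is free as a left $R$-module with basis the free monoid $\langle X\rangle$ of words in $X$, and in which $xr = \sigma_x(r)x + \delta_x(r)$ for all $x \in X$ and $r \in R$. Then $S$ is semiprimitive, i.e. its Jacobson radical is zero. -/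

import Mathlib

/-- `δ` is a `σ`-derivation: an additive map with `δ (a b) = δ a b + σ a δ b`. -/
def IsSkewDerivation {R : Type*} [Ring R] (σ : R →+* R) (δ : R →+ R) : Prop :=
  ∀ a b : R, δ (a * b) = δ a * b + σ a * δ b

/-- A (not necessarily commutative) ring is semiprime if it has no nonzero two-sided ideal
of square zero. -/
def IsSemiprimeRing (R : Type*) [Ring R] : Prop :=
  ∀ I : TwoSidedIdeal R, (∀ a ∈ I, ∀ b ∈ I, a * b = 0) → I = ⊥

/-- The left annihilator `{r | r A = 0}` of a subset `A` of a ring. -/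
def leftAnn {R : Type*} [Ring R] (A : Set R) : Set R :=
  {r : R | ∀ a ∈ A, r * a = 0}

/-- A ring is left Goldie if it contains no infinite direct sum of nonzero left ideals and
satisfies the ascending chain condition on left annihilators of subsets.
(`Ideal R` is the type of left ideals of `R`.) -/
structure IsLeftGoldie (R : Type*) [Ring R] : Prop where
  no_infinite_direct_sum :
    ¬ ∃ I : ℕ → Ideal R, (∀ n, I n ≠ ⊥) ∧ iSupIndep I
  acc_leftAnn :
    ∀ A : ℕ → Set R, (∀ n, leftAnn (A n) ⊆ leftAnn (A (n + 1))) →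
      ∃ n, ∀ m, n ≤ m → leftAnn (A m) = leftAnn (A n)

/-- The ring `S`, with the embedding `i : R → S` and the family `ξ` of elements of `S`
(the variables), is a free skew extension `R[X; (σ x), (δ x)]` of `R`.
For a word `w = x₁ x₂ ⋯ xₙ` in the free monoid, `FreeMonoid.lift ξ w = ξ x₁ * ⋯ * ξ xₙ`. -/
structure IsFreeSkewExtension {R S X : Type*} [Ring R] [Ring S]
    (σ : X → R →+* R) (δ : X → R →+ R) (i : R →+* S) (ξ : X → S) : Prop where
  /-- `R` is a subring of `S`. -/
  injective : Function.Injective i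
  /-- The monomials form a basis of `S` as a left `R`-module: every element of `S` is
  `∑ r_w w` for exactly one finitely supported family `(r_w)` of coefficients in `R`. -/
  basis : ∀ s : S, ∃! f : FreeMonoid X →₀ R,
    s = f.sum fun w r => i r * FreeMonoid.lift ξ w
  /-- `x r = σ_x(r) x + δ_x(r)`. -/
  comm : ∀ (x : X) (r : R), ξ x * i r = i (σ x r) * ξ x + i (δ x r)

/-- A ring is semiprimitive if its Jacobson radical is zero. -/
def IsSemiprimitiveRing (S : Type*) [Ring S] : Prop :=
  Ring.jacobson S = ⊥

namespace FreeSkewExtension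

variable {R : Type*} {X : Type*} [Ring R]

/-- Left multiplication by elements of `R` on the free left module on the words in `X`. -/
noncomputable def scalar (R X : Type*) [Ring R] :
    R →+* AddMonoid.End (FreeMonoid X →₀ R) :=
  Module.toAddMonoidEnd R (FreeMonoid X →₀ R)

/-- The operator `r w ↦ σ_x(r) x w + δ_x(r) w`. -/
noncomputable def var (σ : X → R →+* R) (δ : X → R →+ R) (x : X) :
    AddMonoid.End (FreeMonoid X →₀ R) :=
  Finsupp.liftAddHom fun w =>
    (Finsupp.singleAddHom (FreeMonoid.of x * w)).comp (σ x : R →+ R) +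
      (Finsupp.singleAddHom w).comp (δ x)

theorem scalar_single (a r : R) (w : FreeMonoid X) :
    scalar R X a (Finsupp.single w r) = Finsupp.single w (a * r) :=
  Finsupp.smul_single a w r

theorem var_single (σ : X → R →+* R) (δ : X → R →+ R) (x : X) (w : FreeMonoid X) (r : R) :
    var σ δ x (Finsupp.single w r) =
      Finsupp.single (FreeMonoid.of x * w) (σ x r) + Finsupp.single w (δ x r) :=
  Finsupp.liftAddHom_apply_single _ w r

theorem var_mul_scalar {σ : X → R →+* R} {δ : X → R →+ R}
    (hδ : ∀ x, IsSkewDerivation (σ x) (δ x)) (x : X) (r : R) :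
    var σ δ x * scalar R X r =
      scalar R X (σ x r) * var σ δ x + scalar R X (δ x r) := by
  refine Finsupp.addHom_ext fun w a => ?_
  change var σ δ x (scalar R X r _) =
    scalar R X (σ x r) (var σ δ x _) + scalar R X (δ x r) _
  rw [scalar_single, var_single, var_single, map_add, scalar_single, scalar_single,
    scalar_single, map_mul, hδ x r a, Finsupp.single_add]
  abel

theorem lift_var_one (σ : X → R →+* R) (δ : X → R →+ R)
    (hδ : ∀ x, IsSkewDerivation (σ x) (δ x)) (w : FreeMonoid X) :
    (FreeMonoid.lift (var σ δ) w) (Finsupp.single 1 1) = Finsupp.single w 1 := by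
  have h1 : ∀ x, δ x 1 = 0 := fun x => by
    have := hδ x 1 1
    simpa using this
  induction w using FreeMonoid.inductionOn' with
  | one => simp
  | of_mul x w ih =>
    rw [map_mul, FreeMonoid.lift_eval_of]
    exact (congrArg (var σ δ x) ih).trans (by rw [var_single, h1]; simp)

/-- Free skew extensions exist. -/
theorem exists_isFreeSkewExtension {R : Type*} {X : Type*} [Ring R]
    (σ : X → R →+* R) (δ : X → R →+ R) (hδ : ∀ x, IsSkewDerivation (σ x) (δ x)) :
    ∃ (S : Subring (AddMonoid.End (FreeMonoid X →₀ R))) (i : R →+* S) (ξ : X → S),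
      IsFreeSkewExtension σ δ i ξ := by
  classical
  let S : Subring (AddMonoid.End (FreeMonoid X →₀ R)) :=
    Subring.closure (Set.range (scalar R X) ∪ Set.range (var σ δ))
  let i : R →+* S := (scalar R X).codRestrict S fun r =>
    Subring.subset_closure (Or.inl ⟨r, rfl⟩)
  let ξ : X → S := fun x => ⟨var σ δ x, Subring.subset_closure (Or.inr ⟨x, rfl⟩)⟩
  -- the evaluation of a formal sum of monomials
  let Φ : (FreeMonoid X →₀ R) →+ S := Finsupp.liftAddHom fun w =>
    (AddMonoidHom.mulRight (FreeMonoid.lift ξ w)).comp (i : R →+ S)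
  have hΦ : ∀ f, Φ f = f.sum fun w r => i r * FreeMonoid.lift ξ w := fun f => rfl
  have hΦs : ∀ w r, Φ (Finsupp.single w r) = i r * FreeMonoid.lift ξ w := fun w r => by
    simp [Φ]
  have hcomm : ∀ (x : X) (r : R), ξ x * i r = i (σ x r) * ξ x + i (δ x r) := fun x r =>
    Subtype.ext (var_mul_scalar hδ x r)
  have hlift : ∀ w, ((FreeMonoid.lift ξ w : S) : AddMonoid.End (FreeMonoid X →₀ R)) =
      FreeMonoid.lift (var σ δ) w := fun w => by
    induction w using FreeMonoid.inductionOn' with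
    | one => simp
    | of_mul x w ih => simp [ih, ξ]
  have hΦ1 : ∀ f, ((Φ f : S) : AddMonoid.End (FreeMonoid X →₀ R)) (Finsupp.single 1 1) = f := by
    intro f
    induction f using Finsupp.induction_linear with
    | zero => simp
    | add f g hf hg =>
      rw [map_add, Subring.coe_add]
      change (Φ f : AddMonoid.End (FreeMonoid X →₀ R)) _ +
        (Φ g : AddMonoid.End (FreeMonoid X →₀ R)) _ = _
      rw [hf, hg]
    | single w r =>
      rw [hΦs, Subring.coe_mul, hlift]
      exact (congrArg (scalar R X r) (lift_var_one σ δ hδ w)).trans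
        (by rw [scalar_single, mul_one])
  have hscal : ∀ (r : R) (f), i r * Φ f ∈ Φ.range := by
    intro r f
    induction f using Finsupp.induction_linear with
    | zero => simp
    | add f g hf hg => rw [map_add, mul_add]; exact add_mem hf hg
    | single w a =>
      exact ⟨Finsupp.single w (r * a), by rw [hΦs, hΦs, map_mul, mul_assoc]⟩
  have hvar : ∀ (x : X) (f), ξ x * Φ f ∈ Φ.range := by
    intro x f
    induction f using Finsupp.induction_linear with
    | zero => simp
    | add f g hf hg => rw [map_add, mul_add]; exact add_mem hf hg
    | single w a =>
      refine ⟨Finsupp.single (FreeMonoid.of x * w) (σ x a) + Finsupp.single w (δ x a), ?_⟩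
      rw [map_add, hΦs, hΦs, hΦs, ← mul_assoc, hcomm, map_mul, FreeMonoid.lift_eval_of,
        add_mul, mul_assoc]
  have hmul : ∀ (s) (hs : s ∈ S), ∀ f, (⟨s, hs⟩ : S) * Φ f ∈ Φ.range := by
    intro s hs
    induction hs using Subring.closure_induction with
    | mem s h =>
      rcases h with ⟨r, rfl⟩ | ⟨x, rfl⟩
      · exact hscal r
      · exact hvar x
    | zero => intro f; exact ⟨0, by rw [map_zero]; exact (zero_mul _).symm⟩
    | one => intro f; exact ⟨f, (one_mul _).symm⟩
    | add a b ha hb iha ihb =>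
      intro f
      have := add_mem (iha f) (ihb f)
      rwa [← add_mul] at this
    | neg a ha iha =>
      intro f
      have := neg_mem (iha f)
      rwa [← neg_mul] at this
    | mul a b ha hb iha ihb =>
      intro f
      obtain ⟨g, hg⟩ := ihb f
      have := iha g
      rwa [hg, ← mul_assoc] at this
  refine ⟨S, i, ξ, ⟨fun a b hab => ?_, fun s => ?_, hcomm⟩⟩
  · have h : Φ (Finsupp.single 1 a) = Φ (Finsupp.single 1 b) := by rw [hΦs, hΦs, hab]
    have h2 := hΦ1 (Finsupp.single 1 a)
    rw [h, hΦ1] at h2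
    exact (Finsupp.single_injective _ h2).symm
  · obtain ⟨f, hf⟩ := hmul s.1 s.2 (Finsupp.single 1 1)
    have h1 : Φ (Finsupp.single 1 1) = 1 := by simp [hΦs]
    rw [h1, mul_one] at hf
    refine ⟨f, hf.symm, fun g hg => ?_⟩
    have hg' : Φ f = Φ g := hf.trans hg
    rw [← hΦ1 g, ← hg', hΦ1]

end FreeSkewExtension

/-!
The proof compares top coefficients in a quasi-inverse. Give every variable degree one. Words of
length `m + n` factor uniquely into words of lengths `m` and `n`, so the coefficient of `s * t` at
`v w`, for `|v| = deg s` and `|w| = deg t`, is the single product `s_v * σ_v (t_w)`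
(`IsFreeSkewExtension.coeffs_mul_mul`). Let `J` be the Jacobson radical of `S` and let `I` be the
additive subgroup of `R` generated by the top coefficients of the elements of `J`
(`IsFreeSkewExtension.topIdeal`). It is a two-sided ideal, mapped into itself by every `σ_v`, and
it is zero only if `J` is.

The Goldie condition gives an element `c ∈ I` that no nonzero element of `I` annihilates from the
left (`IsLeftGoldie.exists_mem_forall_mul_eq_zero`). As `c` is a sum of top coefficients, there is
a single `f ∈ J` of degree at most some `n > 0` such that everything annihilating the coefficients
of `f` in degree `n` from the left annihilates `c`
(`IsFreeSkewExtension.exists_forall_mul_coeffs_eq_zero`). So these coefficients have no common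
left annihilator in `I`, and neither have their images under any `σ_v`
(`IsFreeSkewExtension.eq_zero_of_forall_mul_map_coeffs_eq_zero`), because by the chain condition
`I` and `σ_v I` have the same left annihilator.

Let `g ∈ J` be the quasi-inverse of `f`, so `g + f = g * f = f * g`. If `g` had degree `m > 0`,
the product `g * f = g + f` would have no coefficients in degree `m + n > max m n`, so a top
coefficient of `g`, which is in `I`, would annihilate the twisted coefficients of `f` and be zero.
Hence `g` is a scalar.
Reading off constant coefficients in `(1 - g) * (1 - f) = 1`, one sees that `1 - g` has its inverse
`1 - f` in `R`. So the coefficients of `f` in degree `n > 0` vanish, and `I = 0`, `J = 0`.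
-/

/-! ### One-sided annihilators in semiprime left Goldie rings -/

section Goldie

variable {R : Type*} [Ring R]

/-- The elementwise form of semiprimeness. -/
theorem IsSemiprimeRing.eq_zero_of_forall_mul_mul_eq_zero (hR : IsSemiprimeRing R) {a : R}
    (ha : ∀ r, a * r * a = 0) : a = 0 := by
  -- if `b r z = 0` for all `b ∈ s` and all `r`, the same holds for all `b` in the ideal of `s`
  have left : ∀ (z : R) (s : Set R), (∀ b ∈ s, ∀ r, b * r * z = 0) →
      ∀ b ∈ TwoSidedIdeal.span s, ∀ r, b * r * z = 0 := by
    intro z s hs b hb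
    induction hb using TwoSidedIdeal.span_induction with
    | mem x hx => exact hs x hx
    | zero => simp
    | add x y _ _ hx hy => intro r; rw [add_mul, add_mul, hx, hy, add_zero]
    | neg x _ hx => intro r; rw [neg_mul, neg_mul, hx, neg_zero]
    | left_absorb c x _ hx => intro r; rw [mul_assoc c, mul_assoc c, hx, mul_zero]
    | right_absorb c x _ hx => intro r; rw [mul_assoc x, hx]
  have right : ∀ b ∈ TwoSidedIdeal.span {a}, ∀ c ∈ TwoSidedIdeal.span {a}, ∀ r,
      b * r * c = 0 := by
    intro b hb c hc
    induction hc using TwoSidedIdeal.span_induction with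
    | mem x hx =>
      rw [Set.mem_singleton_iff.1 hx]
      exact left a {a} (by simpa using ha) b hb
    | zero => simp
    | add x y _ _ hx hy => intro r; rw [mul_add, hx, hy, add_zero]
    | neg x _ hx => intro r; rw [mul_neg, hx, neg_zero]
    | left_absorb c x _ hx => intro r; rw [← mul_assoc, mul_assoc b, hx]
    | right_absorb c x _ hx => intro r; rw [← mul_assoc, hx, zero_mul]
  have hbot := hR (TwoSidedIdeal.span {a}) fun b hb c hc => by simpa using right b hb c hc 1
  have : a ∈ TwoSidedIdeal.span {a} := TwoSidedIdeal.subset_span rfl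
  rwa [hbot, TwoSidedIdeal.mem_bot] at this

/-- Utumi's argument: a nonzero left ideal of a semiprime ring with the ascending chain condition
on left annihilators is not nil. -/
theorem IsLeftGoldie.exists_mem_not_isNilpotent (hR : IsSemiprimeRing R) (hG : IsLeftGoldie R)
    {L : Ideal R} (hL : L ≠ ⊥) : ∃ a ∈ L, ¬ IsNilpotent a := by
  by_contra! hnil
  obtain ⟨a, haL, ha0⟩ := Submodule.exists_mem_ne_zero_of_ne_bot hL
  -- the right ideal `a R` is nil, since `R a` is
  have hnil' : ∀ r, IsNilpotent (a * r) := by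
    intro r
    obtain ⟨k, hk⟩ := hnil (r * a) (L.mul_mem_left r haL)
    exact ⟨k + 1, by rw [pow_succ, ← mul_assoc, mul_pow_mul, hk, mul_zero, zero_mul]⟩
  -- some nonzero `b ∈ a R` has a left annihilator that is maximal among those of its multiples
  have hwf : ∃ b : R, (∃ r, b = a * r) ∧ b ≠ 0 ∧
      ∀ s, b * s ≠ 0 → leftAnn {b * s} ⊆ leftAnn {b} := by
    by_contra! H
    have H' : ∀ b : {b : R // (∃ r, b = a * r) ∧ b ≠ 0},
        ∃ c : {b : R // (∃ r, b = a * r) ∧ b ≠ 0},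
        leftAnn {b.1} ⊆ leftAnn {c.1} ∧ ¬ leftAnn {c.1} ⊆ leftAnn {b.1} := by
      rintro ⟨b, ⟨r, rfl⟩, hb⟩
      obtain ⟨s, hs, hsub⟩ := H (a * r) ⟨r, rfl⟩ hb
      refine ⟨⟨a * r * s, ⟨r * s, mul_assoc _ _ _⟩, hs⟩, fun t ht => ?_, hsub⟩
      simp only [leftAnn, Set.mem_singleton_iff, forall_eq, Set.mem_ofPred_eq] at ht ⊢
      rw [← mul_assoc, ht, zero_mul]
    choose next h1 h2 using H'
    let u : ℕ → {b : R // (∃ r, b = a * r) ∧ b ≠ 0} := fun n =>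
      next^[n] ⟨a, ⟨1, (mul_one a).symm⟩, ha0⟩
    have hu : ∀ n, u (n + 1) = next (u n) := fun n => Function.iterate_succ_apply' _ _ _
    obtain ⟨n, hn⟩ := hG.acc_leftAnn (fun n => {(u n).1}) fun n => by
      simp only [hu]; exact h1 _
    apply h2 (u n)
    rw [← hu]
    exact (hn (n + 1) n.le_succ).le
  obtain ⟨b, ⟨r, rfl⟩, hb, hmax⟩ := hwf
  refine hb (hR.eq_zero_of_forall_mul_mul_eq_zero fun s => ?_)
  by_cases hs : a * r * s = 0
  · rw [hs, zero_mul]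
  have hbs : IsNilpotent (a * r * s) := by rw [mul_assoc]; exact hnil' _
  -- the last nonzero power of `a r s` has the same left annihilator as `a r`, and this
  -- annihilator contains `a r s`
  obtain ⟨k, hk, hk'⟩ : ∃ k, (a * r * s) ^ k ≠ 0 ∧ (a * r * s) ^ (k + 1) = 0 := by
    have := nontrivial_of_ne _ _ hs
    have hpos := pos_nilpotencyClass_iff.2 hbs
    exact ⟨nilpotencyClass (a * r * s) - 1, pow_pred_nilpotencyClass hbs,
      by rw [Nat.sub_add_cancel hpos]; exact pow_nilpotencyClass hbs⟩
  have hk0 : k ≠ 0 := by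
    rintro rfl
    exact hs (by simpa using hk')
  obtain ⟨j, rfl⟩ := Nat.exists_eq_succ_of_ne_zero hk0
  have hmem : a * r * s ∈ leftAnn {a * r * (s * (a * r * s) ^ j)} := by
    simp only [leftAnn, Set.mem_singleton_iff, forall_eq, Set.mem_ofPred_eq]
    rw [← mul_assoc (a * r) s, ← pow_succ', ← pow_succ']
    exact hk'
  have := hmax (s * (a * r * s) ^ j) (by rwa [← mul_assoc (a * r) s, ← pow_succ']) hmem
  simpa [leftAnn] using this

theorem IsLeftGoldie.exists_mem_forall_mul_mul_self_eq_zero (hR : IsSemiprimeRing R)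
    (hG : IsLeftGoldie R) {L : Ideal R} (hL : L ≠ ⊥) :
    ∃ a ∈ L, a ≠ 0 ∧ ∀ d, d * a * a = 0 → d * a = 0 := by
  obtain ⟨a, haL, ha⟩ := hG.exists_mem_not_isNilpotent hR hL
  obtain ⟨n, hn⟩ := hG.acc_leftAnn (fun n => {a ^ n}) fun n t ht => by
    simp only [leftAnn, Set.mem_singleton_iff, forall_eq, Set.mem_ofPred_eq] at ht ⊢
    rw [pow_succ, ← mul_assoc, ht, zero_mul]
  -- a power of `a` at which the left annihilators have become stationary
  refine ⟨a ^ (n + 1), by rw [pow_succ]; exact L.mul_mem_left _ haL,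
    fun h => ha ⟨_, h⟩, fun d hd => ?_⟩
  have h1 : d ∈ leftAnn {a ^ (n + 1 + (n + 1))} := by
    simpa [leftAnn, pow_add, mul_assoc] using hd
  rw [hn _ (by omega), ← hn (n + 1) n.le_succ] at h1
  simpa [leftAnn] using h1

theorem iSupIndep_span_singleton_of_mul_eq_zero {a : ℕ → R}
    (hsq : ∀ n d, d * a n * a n = 0 → d * a n = 0) (hmul : ∀ m n, m < n → a n * a m = 0) :
    iSupIndep fun n => Ideal.span {a n} := by
  classical
  refine (iSupIndep_iff_finsetSum_eq_zero_imp_eq_zero _).2 fun s v hv hsum => ?_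
  have hd : ∀ n ∈ s, ∃ d, d * a n = v n := fun n hn => Ideal.mem_span_singleton'.1 (hv n hn)
  intro n
  induction n using Nat.strong_induction_on with
  | _ n ih =>
    intro hn
    obtain ⟨d, hdn⟩ := hd n hn
    rw [← hdn]
    apply hsq
    -- multiply the relation on the right by `a n`
    have h := congrArg (· * a n) hsum
    simp only [zero_mul, Finset.sum_mul] at h
    rw [Finset.sum_eq_single n] at h
    · rwa [hdn]
    · intro m hm hmn
      rcases lt_or_gt_of_ne hmn with hlt | hgt
      · rw [ih m hlt hm, zero_mul]
      · obtain ⟨e, he⟩ := hd m hm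
        rw [← he, mul_assoc, hmul n m hgt, mul_zero]
    · exact fun h => absurd hn h

/-- A left ideal `L` of a semiprime left Goldie ring contains an element that no nonzero element
of `L` annihilates from the left. This is the step towards regular elements in Goldie's theorem. -/
theorem IsLeftGoldie.exists_mem_forall_mul_eq_zero (hR : IsSemiprimeRing R)
    (hG : IsLeftGoldie R) (L : Ideal R) : ∃ c ∈ L, ∀ d ∈ L, d * c = 0 → d = 0 := by
  by_contra! H
  -- As long as `c` has a nonzero left annihilator in `L`, an element `a` of that annihilator with
  -- `d a² = 0 → d a = 0` can be added to `c`; the annihilator of `c + a` is strictly smaller.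
  have step : ∀ c : {c : R // c ∈ L ∧ ∀ d, d * c * c = 0 → d * c = 0},
      ∃ a ∈ L, a ≠ 0 ∧ (∀ d, d * a * a = 0 → d * a = 0) ∧ a * c.1 = 0 := by
    rintro ⟨c, hc, -⟩
    obtain ⟨d, hd, hdc, hd0⟩ := H c hc
    have hK : L ⊓ LinearMap.ker (LinearMap.toSpanSingleton R R c) ≠ ⊥ := by
      rw [Submodule.ne_bot_iff]
      exact ⟨d, ⟨hd, by simpa using hdc⟩, hd0⟩
    obtain ⟨a, ⟨haL, hac⟩, ha0, hsq⟩ := hG.exists_mem_forall_mul_mul_self_eq_zero hR hK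
    exact ⟨a, haL, ha0, hsq, by simpa using hac⟩
  choose a haL ha0 hsq hac using step
  have split : ∀ c d, d * (c.1 + a c) = 0 → d * c.1 = 0 ∧ d * a c = 0 := by
    intro c d h
    have h1 : d * c.1 = 0 := by
      apply c.2.2
      have := congrArg (· * c.1) h
      simpa [mul_assoc, add_mul, mul_add, hac] using this
    exact ⟨h1, by simpa [mul_add, h1] using h⟩
  let next : {c : R // c ∈ L ∧ ∀ d, d * c * c = 0 → d * c = 0} →
      {c : R // c ∈ L ∧ ∀ d, d * c * c = 0 → d * c = 0} := fun c =>
    ⟨c.1 + a c, L.add_mem c.2.1 (haL c), fun d hd => by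
      obtain ⟨h1, h2⟩ := split c _ hd
      have h3 : d * c.1 = 0 := by
        apply c.2.2
        apply c.2.2
        have := congrArg (· * c.1) h1
        simpa [mul_assoc, add_mul, mul_add, hac] using this
      have h4 : d * a c = 0 := by
        apply hsq
        simpa [mul_add, add_mul, h3] using h2
      rw [mul_add, h3, h4, add_zero]⟩
  let u : ℕ → {c : R // c ∈ L ∧ ∀ d, d * c * c = 0 → d * c = 0} := fun n =>
    next^[n] ⟨0, L.zero_mem, by simp⟩
  have hu : ∀ n, (u (n + 1)).1 = (u n).1 + a (u n) := fun n =>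
    congrArg Subtype.val (Function.iterate_succ_apply' next n _)
  have hmul : ∀ m n, m < n → ∀ d, d * (u n).1 = 0 → d * a (u m) = 0 := by
    intro m n hmn
    induction n, hmn using Nat.le_induction with
    | base => intro d hd; rw [hu] at hd; exact (split _ _ hd).2
    | succ n _ ih => intro d hd; rw [hu] at hd; exact ih d (split _ _ hd).1
  exact hG.no_infinite_direct_sum ⟨fun n => Ideal.span {a (u n)},
    fun n h => ha0 _ (Ideal.span_singleton_eq_bot.1 h),
    iSupIndep_span_singleton_of_mul_eq_zero (fun n => hsq _)
      fun m n hmn => hmul m n hmn _ (hac _)⟩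

theorem IsSemiprimeRing.eq_zero_of_mem_of_forall_mul_eq_zero (hR : IsSemiprimeRing R)
    {I : Ideal R} {b : R} (hb : b ∈ I) (h : ∀ a ∈ I, b * a = 0) : b = 0 :=
  hR.eq_zero_of_forall_mul_mul_eq_zero fun r => by
    rw [mul_assoc]; exact h _ (I.mul_mem_left r hb)

theorem IsSemiprimeRing.mul_eq_zero_of_forall_mul_eq_zero (hR : IsSemiprimeRing R)
    {I : Ideal R} [I.IsTwoSided] {d : R} (h : ∀ a ∈ I, a * d = 0) {a : R} (ha : a ∈ I) :
    d * a = 0 :=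
  hR.eq_zero_of_forall_mul_mul_eq_zero fun r => by
    rw [mul_assoc d, mul_assoc d, ← mul_assoc (a * r), h _ (I.mul_mem_right r ha), zero_mul,
      mul_zero]

/-- If an automorphism `τ` maps an ideal `I` into itself, then `τ I` still has no left annihilator
in `I`: by the chain condition, `I` and `τ I` have the same left annihilator. -/
theorem IsLeftGoldie.eq_zero_of_forall_mul_map_eq_zero (hR : IsSemiprimeRing R)
    (hG : IsLeftGoldie R) {I : Ideal R} (τ : R ≃+* R) (hτ : ∀ a ∈ I, τ a ∈ I) {b : R}
    (hb : b ∈ I) (h : ∀ a ∈ I, b * τ a = 0) : b = 0 := by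
  refine hR.eq_zero_of_mem_of_forall_mul_eq_zero hb fun a ha => ?_
  have hsucc : ∀ n a, (τ ^ (n + 1)) a = (τ ^ n) (τ a) := fun n a => by
    rw [pow_succ, RingAut.mul_apply]
  obtain ⟨n, hn⟩ := hG.acc_leftAnn (fun n => (τ ^ n) '' I) fun n t ht => by
    rintro _ ⟨a, ha, rfl⟩
    exact ht _ ⟨τ a, hτ a ha, (hsucc n a).symm⟩
  have h1 : (τ ^ n) b ∈ leftAnn ((τ ^ (n + 1)) '' (I : Set R)) := by
    rintro _ ⟨a, ha, rfl⟩
    rw [hsucc, ← map_mul, h a ha, map_zero]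
  have h2 := (hn (n + 1) n.le_succ).le h1 _ ⟨a, ha, rfl⟩
  rwa [← map_mul, EmbeddingLike.map_eq_zero_iff] at h2

end Goldie

/-! ### Coefficients and degrees in a free skew extension -/

namespace IsFreeSkewExtension

section Coeffs

variable {R S X : Type*} [Ring R] [Ring S] {σ : X → R →+* R} {δ : X → R →+ R}
  {i : R →+* S} {ξ : X → S} (hS : IsFreeSkewExtension σ δ i ξ)

/-- The evaluation `(r_w) ↦ ∑ r_w w` of a family of coefficients. -/
noncomputable def evalHom (i : R →+* S) (ξ : X → S) : (FreeMonoid X →₀ R) →+ S :=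
  Finsupp.liftAddHom fun w => (AddMonoidHom.mulRight (FreeMonoid.lift ξ w)).comp (i : R →+ S)

theorem evalHom_single (i : R →+* S) (ξ : X → S) (w : FreeMonoid X) (r : R) :
    evalHom i ξ (Finsupp.single w r) = i r * FreeMonoid.lift ξ w := by
  simp [evalHom]

/-- The family of left coefficients of an element of a free skew extension. -/
noncomputable def coeffs : S ≃+ (FreeMonoid X →₀ R) :=
  (AddEquiv.ofBijective (evalHom i ξ)
    ⟨fun f _ h => (hS.basis (evalHom i ξ f)).unique rfl h,
      fun s => (hS.basis s).exists.imp fun _ h => h.symm⟩).symm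

theorem coeffs_monomial (r : R) (w : FreeMonoid X) :
    hS.coeffs (i r * FreeMonoid.lift ξ w) = Finsupp.single w r := by
  rw [← evalHom_single]
  exact (AddEquiv.ofBijective (evalHom i ξ) _).symm_apply_apply _

theorem sum_coeffs (s : S) :
    s = (hS.coeffs s).sum fun w r => i r * FreeMonoid.lift ξ w :=
  ((AddEquiv.ofBijective (evalHom i ξ) _).apply_symm_apply s).symm

theorem induction_on (hS : IsFreeSkewExtension σ δ i ξ) {p : S → Prop} (s : S) (zero : p 0)
    (add : ∀ s t, p s → p t → p (s + t))
    (monomial : ∀ r w, p (i r * FreeMonoid.lift ξ w)) : p s := by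
  rw [hS.sum_coeffs s]
  exact Finset.sum_induction _ p add zero fun w _ => monomial _ w

theorem coeffs_scalar (r : R) : hS.coeffs (i r) = Finsupp.single 1 r := by
  simpa using hS.coeffs_monomial r 1

theorem coeffs_scalar_mul (r : R) (s : S) (w : FreeMonoid X) :
    hS.coeffs (i r * s) w = r * hS.coeffs s w := by
  induction s using hS.induction_on with
  | zero => simp
  | add s t hs ht => simp [mul_add, hs, ht]
  | monomial a v =>
    rw [← mul_assoc, ← map_mul, coeffs_monomial, coeffs_monomial, ← Finsupp.smul_single']
    rfl

theorem coeffs_mul_word_mul (s : S) (w u : FreeMonoid X) :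
    hS.coeffs (s * FreeMonoid.lift ξ u) (w * u) = hS.coeffs s w := by
  classical
  induction s using hS.induction_on with
  | zero => simp
  | add s t hs ht => simp [add_mul, hs, ht]
  | monomial a v =>
    rw [mul_assoc, ← map_mul, coeffs_monomial, coeffs_monomial, Finsupp.single_apply,
      Finsupp.single_apply]
    simp only [mul_left_inj]

theorem coeffs_mul_word_of_forall_ne (s : S) {u z : FreeMonoid X} (h : ∀ w, w * u ≠ z) :
    hS.coeffs (s * FreeMonoid.lift ξ u) z = 0 := by
  induction s using hS.induction_on with
  | zero => simp
  | add s t hs ht => simp [add_mul, hs, ht]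
  | monomial a v =>
    rw [mul_assoc, ← map_mul, coeffs_monomial, Finsupp.single_eq_of_ne' (h v)]

theorem coeffs_var_mul_monomial (x : X) (r : R) (w : FreeMonoid X) :
    hS.coeffs (ξ x * (i r * FreeMonoid.lift ξ w)) =
      Finsupp.single (FreeMonoid.of x * w) (σ x r) + Finsupp.single w (δ x r) := by
  rw [← mul_assoc, hS.comm, add_mul, map_add, coeffs_monomial, mul_assoc,
    ← FreeMonoid.lift_eval_of ξ x, ← map_mul, coeffs_monomial]

theorem coeffs_var_mul_of_mul (x : X) (s : S) (w : FreeMonoid X) :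
    hS.coeffs (ξ x * s) (FreeMonoid.of x * w) =
      σ x (hS.coeffs s w) + δ x (hS.coeffs s (FreeMonoid.of x * w)) := by
  classical
  induction s using hS.induction_on with
  | zero => simp
  | add s t hs ht => simp only [mul_add, map_add, Finsupp.add_apply, hs, ht]; abel
  | monomial a v =>
    rw [coeffs_var_mul_monomial, coeffs_monomial]
    simp only [Finsupp.add_apply, Finsupp.single_apply, mul_right_inj]
    split_ifs <;> simp

theorem coeffs_var_mul_of_forall_ne (x : X) (s : S) {z : FreeMonoid X}
    (h : ∀ w, FreeMonoid.of x * w ≠ z) : hS.coeffs (ξ x * s) z = δ x (hS.coeffs s z) := by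
  classical
  induction s using hS.induction_on with
  | zero => simp
  | add s t hs ht => simp only [mul_add, map_add, Finsupp.add_apply, hs, ht]
  | monomial a v =>
    rw [coeffs_var_mul_monomial, coeffs_monomial, Finsupp.add_apply,
      Finsupp.single_eq_of_ne' (h v), zero_add]
    simp only [Finsupp.single_apply]
    split_ifs <;> simp

/-- The elements of degree at most `n`, where every variable has degree one. -/
def degreeLE (n : ℕ) : AddSubgroup S where
  carrier := {s | ∀ w : FreeMonoid X, n < w.length → hS.coeffs s w = 0}
  zero_mem' := by simp
  add_mem' hs ht w hw := by simp [hs w hw, ht w hw]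
  neg_mem' hs w hw := by simp [hs w hw]

theorem exists_mem_degreeLE (s : S) : ∃ n, s ∈ hS.degreeLE n := by
  refine ⟨(hS.coeffs s).support.sup FreeMonoid.length, fun w hw => ?_⟩
  by_contra h
  exact hw.not_ge (Finset.le_sup (f := FreeMonoid.length) (Finsupp.mem_support_iff.2 h))

theorem mem_degreeLE_of_coeffs_eq_zero {n : ℕ} {s : S} (hs : s ∈ hS.degreeLE (n + 1))
    (h : ∀ w : FreeMonoid X, w.length = n + 1 → hS.coeffs s w = 0) : s ∈ hS.degreeLE n :=
  fun w hw => by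
    rcases Nat.lt_or_ge (n + 1) w.length with h1 | h1
    · exact hs w h1
    · exact h w (le_antisymm h1 hw)

theorem eq_scalar_of_mem_degreeLE_zero {s : S} (hs : s ∈ hS.degreeLE 0) :
    s = i (hS.coeffs s 1) := by
  have h : hS.coeffs s = Finsupp.single 1 (hS.coeffs s 1) := by
    ext w
    by_cases hw : w = 1
    · simp [hw]
    · rw [Finsupp.single_eq_of_ne hw]
      exact hs w (Nat.pos_of_ne_zero fun h => hw (FreeMonoid.length_eq_zero.1 h))
  apply hS.coeffs.injective
  rw [coeffs_scalar]
  exact h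

theorem scalar_mem_degreeLE (r : R) (n : ℕ) : i r ∈ hS.degreeLE n := fun w hw => by
  rw [coeffs_scalar, Finsupp.single_eq_of_ne]
  rintro rfl
  simp at hw

theorem mul_word_mem_degreeLE {n : ℕ} {s : S} (hs : s ∈ hS.degreeLE n) (u : FreeMonoid X) :
    s * FreeMonoid.lift ξ u ∈ hS.degreeLE (n + u.length) := fun z hz => by
  by_cases h : ∃ w, w * u = z
  · obtain ⟨w, rfl⟩ := h
    rw [coeffs_mul_word_mul]
    refine hs w ?_
    rw [FreeMonoid.length_mul] at hz
    omega
  · exact hS.coeffs_mul_word_of_forall_ne s (not_exists.1 h)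

end Coeffs

section Automorphisms

variable {R S X : Type*} [Ring R] [Ring S] {σ : X → R ≃+* R} {δ : X → R →+ R}
  {i : R →+* S} {ξ : X → S} (hS : IsFreeSkewExtension (fun x => (σ x : R →+* R)) δ i ξ)

theorem var_mul_mem_degreeLE (x : X) {n : ℕ} {s : S} (hs : s ∈ hS.degreeLE n) :
    ξ x * s ∈ hS.degreeLE (n + 1) := fun z hz => by
  by_cases h : ∃ w, FreeMonoid.of x * w = z
  · obtain ⟨w, rfl⟩ := h
    rw [FreeMonoid.length_mul, FreeMonoid.length_of] at hz
    rw [coeffs_var_mul_of_mul, hs w (by omega), hs (FreeMonoid.of x * w), map_zero, map_zero,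
      add_zero]
    rw [FreeMonoid.length_mul, FreeMonoid.length_of]
    omega
  · rw [hS.coeffs_var_mul_of_forall_ne x s (not_exists.1 h), hs z (by omega), map_zero]

theorem word_mul_mem_degreeLE (v : FreeMonoid X) {n : ℕ} {s : S} (hs : s ∈ hS.degreeLE n) :
    FreeMonoid.lift ξ v * s ∈ hS.degreeLE (v.length + n) := by
  induction v using FreeMonoid.inductionOn' with
  | one => simpa using hs
  | of_mul x v ih =>
    rw [map_mul, FreeMonoid.lift_eval_of, mul_assoc, FreeMonoid.length_mul, FreeMonoid.length_of,
      add_comm 1, add_right_comm]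
    exact hS.var_mul_mem_degreeLE x ih

/-- Moving a word `v` past the coefficients of an element twists its top coefficients by the
composite `FreeMonoid.lift σ v` of the automorphisms attached to the letters of `v`. -/
theorem coeffs_word_mul_mul (v w : FreeMonoid X) {n : ℕ} {s : S} (hs : s ∈ hS.degreeLE n)
    (hw : w.length = n) :
    hS.coeffs (FreeMonoid.lift ξ v * s) (v * w) =
      (FreeMonoid.lift σ v : R ≃+* R) (hS.coeffs s w) := by
  induction v using FreeMonoid.inductionOn' with
  | one => simp
  | of_mul x v ih =>
    rw [map_mul (FreeMonoid.lift ξ), FreeMonoid.lift_eval_of, mul_assoc, mul_assoc,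
      coeffs_var_mul_of_mul, ih, hS.word_mul_mem_degreeLE v hs (FreeMonoid.of x * (v * w)), map_zero,
      add_zero, map_mul, FreeMonoid.lift_eval_of]
    · rfl
    · rw [FreeMonoid.length_mul, FreeMonoid.length_mul, FreeMonoid.length_of]
      omega

theorem coeffs_word_mul_mul_of_ne {v u : FreeMonoid X} (hvu : u ≠ v) (h : u.length = v.length)
    (w : FreeMonoid X) {n : ℕ} {s : S} (hs : s ∈ hS.degreeLE n) (hw : w.length = n) :
    hS.coeffs (FreeMonoid.lift ξ v * s) (u * w) = 0 := by
  induction v using FreeMonoid.inductionOn' generalizing u with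
  | one => exact absurd (FreeMonoid.length_eq_zero.1 h) hvu
  | of_mul x v ih =>
    cases u using FreeMonoid.casesOn with
    | one =>
      rw [FreeMonoid.length_mul, FreeMonoid.length_of, FreeMonoid.length_one] at h
      omega
    | of_mul y u =>
      simp only [FreeMonoid.length_mul, FreeMonoid.length_of, Nat.add_left_cancel_iff] at h
      have hdeg : hS.coeffs (FreeMonoid.lift ξ v * s) (FreeMonoid.of y * (u * w)) = 0 := by
        refine hS.word_mul_mem_degreeLE v hs _ ?_
        rw [FreeMonoid.length_mul, FreeMonoid.length_mul, FreeMonoid.length_of]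
        omega
      rw [map_mul (FreeMonoid.lift ξ), FreeMonoid.lift_eval_of, mul_assoc, mul_assoc]
      by_cases hxy : y = x
      · subst hxy
        rw [coeffs_var_mul_of_mul, ih (fun e => hvu (by rw [e])) h, hdeg, map_zero, map_zero,
          add_zero]
      · rw [hS.coeffs_var_mul_of_forall_ne, hdeg, map_zero]
        intro z hz
        exact hxy (List.cons.inj hz).1.symm

theorem coeffs_mul (s t : S) (z : FreeMonoid X) :
    hS.coeffs (s * t) z =
      ∑ u ∈ (hS.coeffs s).support, hS.coeffs s u * hS.coeffs (FreeMonoid.lift ξ u * t) z := by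
  conv_lhs => rw [hS.sum_coeffs s, Finsupp.sum, Finset.sum_mul, map_sum, Finsupp.finsetSum_apply]
  exact Finset.sum_congr rfl fun u _ => by rw [mul_assoc, coeffs_scalar_mul]

theorem mul_mem_degreeLE {m n : ℕ} {s t : S} (hs : s ∈ hS.degreeLE m) (ht : t ∈ hS.degreeLE n) :
    s * t ∈ hS.degreeLE (m + n) := fun z hz => by
  rw [coeffs_mul]
  refine Finset.sum_eq_zero fun u hu => ?_
  have hu' : u.length ≤ m := not_lt.1 fun h => Finsupp.mem_support_iff.1 hu (hs u h)
  rw [hS.word_mul_mem_degreeLE u ht z (by omega), mul_zero]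

/-- The top coefficients of a product: since words of length `m + n` factor uniquely into words of
lengths `m` and `n`, each of them is a single product. -/
theorem coeffs_mul_mul {m n : ℕ} {s t : S} (hs : s ∈ hS.degreeLE m) (ht : t ∈ hS.degreeLE n)
    {v w : FreeMonoid X} (hv : v.length = m) (hw : w.length = n) :
    hS.coeffs (s * t) (v * w) =
      hS.coeffs s v * (FreeMonoid.lift σ v : R ≃+* R) (hS.coeffs t w) := by
  rw [coeffs_mul, Finset.sum_eq_single v]
  · rw [hS.coeffs_word_mul_mul v w ht hw]
  · intro u hu huv
    have hu' : u.length ≤ m := not_lt.1 fun h => Finsupp.mem_support_iff.1 hu (hs u h)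
    rcases hu'.lt_or_eq with h | h
    · rw [hS.word_mul_mem_degreeLE u ht (v * w), mul_zero]
      rw [FreeMonoid.length_mul]
      omega
    · rw [hS.coeffs_word_mul_mul_of_ne huv.symm (hv.trans h.symm) w ht hw, mul_zero]
  · intro h
    rw [Finsupp.notMem_support_iff.1 h, zero_mul]

end Automorphisms

end IsFreeSkewExtension

/-! ### The ideal generated by the top coefficients of an ideal -/

namespace IsFreeSkewExtension

variable {R S X : Type*} [Ring R] [Ring S] {σ : X → R ≃+* R} {δ : X → R →+ R}
  {i : R →+* S} {ξ : X → S} (hS : IsFreeSkewExtension (fun x => (σ x : R →+* R)) δ i ξ)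

/-- The coefficients at the words of length `n` of the elements of `J` of degree at most `n`,
for all `n`. -/
def topCoeffs (J : Ideal S) : Set R :=
  {c | ∃ n, ∃ f ∈ J, f ∈ hS.degreeLE n ∧ ∃ w : FreeMonoid X, w.length = n ∧ hS.coeffs f w = c}

theorem mul_mem_topCoeffs {J : Ideal S} (r : R) {c : R} (hc : c ∈ hS.topCoeffs J) :
    r * c ∈ hS.topCoeffs J := by
  obtain ⟨n, f, hfJ, hf, w, hw, rfl⟩ := hc
  refine ⟨n, i r * f, J.mul_mem_left _ hfJ, ?_, w, hw, hS.coeffs_scalar_mul r f w⟩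
  have := hS.mul_mem_degreeLE (hS.scalar_mem_degreeLE r 0) hf
  rwa [zero_add] at this

theorem mul_right_mem_topCoeffs {J : Ideal S} [J.IsTwoSided] {c : R} (hc : c ∈ hS.topCoeffs J)
    (r : R) : c * r ∈ hS.topCoeffs J := by
  obtain ⟨n, f, hfJ, hf, w, hw, rfl⟩ := hc
  -- a scalar on the right is twisted by `σ_w`, which is surjective
  set a : R := (FreeMonoid.lift σ w : R ≃+* R).symm r with ha
  refine ⟨n, f * i a, J.mul_mem_right _ hfJ,
    hS.mul_mem_degreeLE hf (hS.scalar_mem_degreeLE a 0), w, hw, ?_⟩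
  have := hS.coeffs_mul_mul hf (hS.scalar_mem_degreeLE a 0) hw FreeMonoid.length_one
  rwa [mul_one, hS.coeffs_scalar, Finsupp.single_eq_same, ha, RingEquiv.apply_symm_apply] at this

theorem map_mem_topCoeffs {J : Ideal S} (v : FreeMonoid X) {c : R} (hc : c ∈ hS.topCoeffs J) :
    (FreeMonoid.lift σ v : R ≃+* R) c ∈ hS.topCoeffs J := by
  obtain ⟨n, f, hfJ, hf, w, hw, rfl⟩ := hc
  exact ⟨v.length + n, FreeMonoid.lift ξ v * f, J.mul_mem_left _ hfJ,
    hS.word_mul_mem_degreeLE v hf, v * w, by rw [FreeMonoid.length_mul, hw],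
    hS.coeffs_word_mul_mul v w hf hw⟩

/-- The additive subgroup generated by the top coefficients of the elements of `J`; it is a left
ideal, and a two-sided one if `J` is. -/
def topIdeal (J : Ideal S) : Ideal R where
  __ := AddSubgroup.closure (hS.topCoeffs J)
  smul_mem' r c hc := by
    change r * c ∈ AddSubgroup.closure (hS.topCoeffs J)
    replace hc : c ∈ AddSubgroup.closure (hS.topCoeffs J) := hc
    induction hc using AddSubgroup.closure_induction with
    | mem c hc => exact AddSubgroup.subset_closure (hS.mul_mem_topCoeffs r hc)
    | zero => rw [mul_zero]; exact zero_mem _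
    | add c d _ _ hc hd => rw [mul_add]; exact add_mem hc hd
    | neg c _ hc => rw [mul_neg]; exact neg_mem hc

theorem mem_topIdeal {J : Ideal S} {c : R} :
    c ∈ hS.topIdeal J ↔ c ∈ AddSubgroup.closure (hS.topCoeffs J) :=
  Iff.rfl

theorem topCoeffs_subset_topIdeal (J : Ideal S) : hS.topCoeffs J ⊆ hS.topIdeal J :=
  AddSubgroup.subset_closure

instance isTwoSided_topIdeal (J : Ideal S) [J.IsTwoSided] : (hS.topIdeal J).IsTwoSided where
  mul_mem_of_left r hc := by
    rw [mem_topIdeal] at hc ⊢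
    induction hc using AddSubgroup.closure_induction with
    | mem c hc => exact AddSubgroup.subset_closure (hS.mul_right_mem_topCoeffs hc r)
    | zero => rw [zero_mul]; exact zero_mem _
    | add c d _ _ hc hd => rw [add_mul]; exact add_mem hc hd
    | neg c _ hc => rw [neg_mul]; exact neg_mem hc

theorem map_mem_topIdeal {J : Ideal S} (v : FreeMonoid X) {c : R} (hc : c ∈ hS.topIdeal J) :
    (FreeMonoid.lift σ v : R ≃+* R) c ∈ hS.topIdeal J := by
  rw [mem_topIdeal] at hc ⊢
  induction hc using AddSubgroup.closure_induction with
  | mem c hc => exact AddSubgroup.subset_closure (hS.map_mem_topCoeffs v hc)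
  | zero => rw [map_zero]; exact zero_mem _
  | add c d _ _ hc hd => rw [map_add]; exact add_mem hc hd
  | neg c _ hc => rw [map_neg]; exact neg_mem hc

theorem eq_zero_of_topIdeal_eq_bot {J : Ideal S} (h : hS.topIdeal J = ⊥) {f : S} (hf : f ∈ J) :
    f = 0 := by
  have key : ∀ n, f ∈ hS.degreeLE n → f = 0 := by
    intro n
    induction n with
    | zero =>
      intro hn
      have := hS.topCoeffs_subset_topIdeal J ⟨0, f, hf, hn, 1, FreeMonoid.length_one, rfl⟩
      rw [h] at this
      rw [hS.eq_scalar_of_mem_degreeLE_zero hn, (Submodule.mem_bot R).1 this, map_zero]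
    | succ n ih =>
      refine fun hn => ih (hS.mem_degreeLE_of_coeffs_eq_zero hn fun w hw => ?_)
      have := hS.topCoeffs_subset_topIdeal J ⟨n + 1, f, hf, hn, w, hw, rfl⟩
      rw [h] at this
      exact (Submodule.mem_bot R).1 this
  obtain ⟨n, hn⟩ := hS.exists_mem_degreeLE f
  exact key n hn

/-- With a single variable there is only one word of each length, and the top coefficients of an
ideal are closed under addition. -/
theorem exists_coeffs_eq_of_mem_topIdeal [Nonempty X] [Subsingleton X] {J : Ideal S}
    [J.IsTwoSided] {c : R} (hc : c ∈ hS.topIdeal J) :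
    ∃ n, 0 < n ∧ ∃ f ∈ J, f ∈ hS.degreeLE n ∧
      ∃ w : FreeMonoid X, w.length = n ∧ hS.coeffs f w = c := by
  obtain ⟨x⟩ := ‹Nonempty X›
  rw [mem_topIdeal] at hc
  induction hc using AddSubgroup.closure_induction with
  | mem c hc =>
    -- multiplication by a variable makes the degree bound positive
    obtain ⟨n, f, hfJ, hf, w, hw, rfl⟩ := hc
    exact ⟨n + 1, n.succ_pos, f * FreeMonoid.lift ξ (.of x), J.mul_mem_right _ hfJ,
      hS.mul_word_mem_degreeLE hf (.of x), w * .of x, by rw [FreeMonoid.length_mul, hw]; rfl,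
      hS.coeffs_mul_word_mul f w _⟩
  | zero => exact ⟨1, one_pos, 0, J.zero_mem, zero_mem _, .of x, rfl, by simp⟩
  | neg c _ hc =>
    obtain ⟨n, hn, f, hfJ, hf, w, hw, rfl⟩ := hc
    exact ⟨n, hn, -f, J.neg_mem hfJ, neg_mem hf, w, hw, by simp⟩
  | add c d _ _ hc hd =>
    obtain ⟨m, hm, f, hfJ, hf, v, hv, rfl⟩ := hc
    obtain ⟨n, hn, g, hgJ, hg, w, hw, rfl⟩ := hd
    have hvw : v * w = w * v := by
      apply FreeMonoid.toList.injective
      refine List.ext_getElem ?_ fun _ _ _ => Subsingleton.elim _ _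
      change (v * w).length = (w * v).length
      rw [FreeMonoid.length_mul, FreeMonoid.length_mul, add_comm]
    refine ⟨m + n, by omega, f * FreeMonoid.lift ξ w + g * FreeMonoid.lift ξ v,
      J.add_mem (J.mul_mem_right _ hfJ) (J.mul_mem_right _ hgJ), add_mem ?_ ?_, v * w,
      by rw [FreeMonoid.length_mul, hv, hw], ?_⟩
    · have := hS.mul_word_mem_degreeLE hf w
      rwa [hw] at this
    · have := hS.mul_word_mem_degreeLE hg v
      rwa [hv, add_comm] at this
    · rw [map_add, Finsupp.add_apply, coeffs_mul_word_mul, hvw, coeffs_mul_word_mul]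

/-- With at least two variables, two elements of an ideal can be combined into one whose top
coefficients include those of both: multiply them on the right by words ending in different
letters. -/
theorem exists_forall_mul_coeffs_eq_zero_of_nontrivial [Nontrivial X] {J : Ideal S}
    [J.IsTwoSided] {c : R} (hc : c ∈ hS.topIdeal J) :
    ∃ n, 0 < n ∧ ∃ f ∈ J, f ∈ hS.degreeLE n ∧ ∀ d : R,
      (∀ w : FreeMonoid X, w.length = n → d * hS.coeffs f w = 0) → d * c = 0 := by
  obtain ⟨x, y, hxy⟩ := exists_pair_ne X
  have hlen : ∀ (z : X) (k : ℕ), (FreeMonoid.of z ^ k).length = k := by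
    intro z k
    induction k with
    | zero => rfl
    | succ k ih => rw [pow_succ, FreeMonoid.length_mul, ih, FreeMonoid.length_of]
  have hne : ∀ (u v : FreeMonoid X) {a b : X}, a ≠ b → ∀ k l : ℕ,
      u * FreeMonoid.of a ^ (k + 1) ≠ v * FreeMonoid.of b ^ (l + 1) := by
    intro u v a b hab k l h
    rw [pow_succ, pow_succ, ← mul_assoc, ← mul_assoc] at h
    exact hab (List.cons.inj (List.append_inj' (congrArg FreeMonoid.toList h) rfl).2).1
  rw [mem_topIdeal] at hc
  induction hc using AddSubgroup.closure_induction with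
  | mem c hc =>
    obtain ⟨n, f, hfJ, hf, w, hw, rfl⟩ := hc
    refine ⟨n + 1, n.succ_pos, f * FreeMonoid.lift ξ (.of x), J.mul_mem_right _ hfJ,
      hS.mul_word_mem_degreeLE hf (.of x), fun d hd => ?_⟩
    rw [← hS.coeffs_mul_word_mul f w (.of x)]
    exact hd _ (by rw [FreeMonoid.length_mul, hw]; rfl)
  | zero => exact ⟨1, one_pos, 0, J.zero_mem, zero_mem _, fun d _ => mul_zero d⟩
  | neg c _ hc =>
    obtain ⟨n, hn, f, hfJ, hf, h⟩ := hc
    exact ⟨n, hn, f, hfJ, hf, fun d hd => by rw [mul_neg, h d hd, neg_zero]⟩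
  | add c d _ _ hc hd =>
    obtain ⟨m, hm, f, hfJ, hf, hfc⟩ := hc
    obtain ⟨n, hn, g, hgJ, hg, hgd⟩ := hd
    refine ⟨m + n + 1, by omega, f * FreeMonoid.lift ξ (.of x ^ (n + 1)) +
      g * FreeMonoid.lift ξ (.of y ^ (m + 1)),
      J.add_mem (J.mul_mem_right _ hfJ) (J.mul_mem_right _ hgJ), add_mem ?_ ?_, fun e he => ?_⟩
    · have := hS.mul_word_mem_degreeLE hf (.of x ^ (n + 1))
      rwa [hlen, ← add_assoc] at this
    · have := hS.mul_word_mem_degreeLE hg (.of y ^ (m + 1))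
      rwa [hlen, ← add_assoc, add_comm n m] at this
    · rw [mul_add, hfc e fun w hw => ?_, hgd e fun w hw => ?_, add_zero]
      · have := he (w * .of y ^ (m + 1)) (by rw [FreeMonoid.length_mul, hlen, hw]; omega)
        rwa [map_add, Finsupp.add_apply, coeffs_mul_word_mul,
          hS.coeffs_mul_word_of_forall_ne f fun v => hne v w hxy n m, zero_add] at this
      · have := he (w * .of x ^ (n + 1)) (by rw [FreeMonoid.length_mul, hlen, hw]; omega)
        rwa [map_add, Finsupp.add_apply, coeffs_mul_word_mul,
          hS.coeffs_mul_word_of_forall_ne g fun v => hne v w hxy.symm m n, add_zero] at this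

theorem exists_forall_mul_coeffs_eq_zero [Nonempty X] {J : Ideal S} [J.IsTwoSided] {c : R}
    (hc : c ∈ hS.topIdeal J) :
    ∃ n, 0 < n ∧ ∃ f ∈ J, f ∈ hS.degreeLE n ∧ ∀ d : R,
      (∀ w : FreeMonoid X, w.length = n → d * hS.coeffs f w = 0) → d * c = 0 := by
  rcases subsingleton_or_nontrivial X with hX | hX
  · obtain ⟨n, hn, f, hfJ, hf, w, hw, rfl⟩ := hS.exists_coeffs_eq_of_mem_topIdeal hc
    exact ⟨n, hn, f, hfJ, hf, fun d hd => hd w hw⟩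
  · exact hS.exists_forall_mul_coeffs_eq_zero_of_nontrivial hc

/-- If no nonzero element of the top ideal of `J` annihilates all coefficients of `f` at words of
length `n` from the left, then the same holds for the images of these coefficients under
`FreeMonoid.lift σ v`. -/
theorem eq_zero_of_forall_mul_map_coeffs_eq_zero (hR : IsSemiprimeRing R) (hG : IsLeftGoldie R)
    {J : Ideal S} [J.IsTwoSided] {f : S} {n : ℕ}
    (hf : ∀ d ∈ hS.topIdeal J,
      (∀ w : FreeMonoid X, w.length = n → d * hS.coeffs f w = 0) → d = 0)
    {b : R} (hb : b ∈ hS.topIdeal J) (v : FreeMonoid X)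
    (h : ∀ w : FreeMonoid X, w.length = n →
      b * (FreeMonoid.lift σ v : R ≃+* R) (hS.coeffs f w) = 0) : b = 0 := by
  set τ : R ≃+* R := FreeMonoid.lift σ v with hτ
  -- `τ⁻¹ b` need not lie in the ideal, but its left multiples by elements of the ideal do
  have h1 : ∀ a ∈ hS.topIdeal J, a * τ.symm b = 0 := by
    refine fun a ha => hf _ ((hS.topIdeal J).mul_mem_right _ ha) fun w hw => ?_
    have h2 := congrArg τ.symm (h w hw)
    rw [map_mul, RingEquiv.symm_apply_apply, map_zero] at h2
    rw [mul_assoc, h2, mul_zero]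
  refine hG.eq_zero_of_forall_mul_map_eq_zero hR τ (fun a => hS.map_mem_topIdeal v) hb ?_
  intro a ha
  have h2 := congrArg τ (hR.mul_eq_zero_of_forall_mul_eq_zero h1 ha)
  rwa [map_mul, RingEquiv.apply_symm_apply, map_zero] at h2

end IsFreeSkewExtension

/-! ### Quasi-inverses in the Jacobson radical -/

/-- Elements of the Jacobson radical have two-sided quasi-inverses `g`, that is,
`1 - g = (1 - f)⁻¹`, and these lie in the radical. -/
theorem Ring.exists_mem_jacobson_add_eq_mul {S : Type*} [Ring S] {f : S}
    (hf : f ∈ Ring.jacobson S) :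
    ∃ g ∈ Ring.jacobson S, g + f = g * f ∧ g + f = f * g := by
  have left : ∀ f ∈ Ring.jacobson S, ∃ g ∈ Ring.jacobson S, g + f = g * f := by
    intro f hf
    have hf' : f ∈ (⊥ : Ideal S).jacobson := by rwa [Ideal.jacobson_bot]
    obtain ⟨z, hz⟩ := Ideal.mem_jacobson_iff.1 hf' (-1)
    have hz' : z - 1 = z * f := by
      have : z * -1 * f + z - 1 = 0 := by simpa using hz
      rw [← sub_eq_zero, ← this]
      noncomm_ring
    refine ⟨1 - z, ?_, ?_⟩
    · rw [← neg_sub, hz']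
      exact neg_mem (Ideal.mul_mem_left _ _ hf)
    · rw [sub_mul, one_mul, ← hz']; abel
  obtain ⟨g, hg, h1⟩ := left f hf
  obtain ⟨k, hk, h2⟩ := left g hg
  -- `1 - g` has the left inverse `1 - k` and the right inverse `1 - f`
  have h3 : k = f := by
    have e1 : (1 - g) * (1 - f) = 1 := by
      have : (1 - g) * (1 - f) = 1 - (g + f) + g * f := by noncomm_ring
      rw [this, h1]; abel
    have e2 : (1 - k) * (1 - g) = 1 := by
      have : (1 - k) * (1 - g) = 1 - (k + g) + k * g := by noncomm_ring
      rw [this, h2]; abel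
    exact sub_right_injective (left_inv_eq_right_inv e2 e1)
  refine ⟨g, hg, h1, ?_⟩
  rw [← h3, ← h2, add_comm]

/-! ### Semiprimitivity -/

theorem theoremA {R S X : Type*} [Ring R] [Ring S] [Nonempty X]
    (hsemiprime : IsSemiprimeRing R) (hGoldie : IsLeftGoldie R)
    (σ : X → R ≃+* R) (δ : X → R →+ R)
    (hδ : ∀ x, IsSkewDerivation (σ x : R →+* R) (δ x))
    (i : R →+* S) (ξ : X → S)
    (hS : IsFreeSkewExtension (fun x => (σ x : R →+* R)) δ i ξ) :
    IsSemiprimitiveRing S := by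
  set I := hS.topIdeal (Ring.jacobson S) with hI
  obtain ⟨c, hcI, hc⟩ := hGoldie.exists_mem_forall_mul_eq_zero hsemiprime I
  obtain ⟨n, hn, f, hfJ, hf, hfc⟩ := hS.exists_forall_mul_coeffs_eq_zero hcI
  obtain ⟨g, hgJ, hgf, hfg⟩ := Ring.exists_mem_jacobson_add_eq_mul hfJ
  -- in positive degree, the top coefficients of `g` vanish by comparison with those of `g * f`
  have hg : ∀ m, g ∈ hS.degreeLE m → g ∈ hS.degreeLE 0 := by
    intro m
    induction m with
    | zero => exact id
    | succ m ih =>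
      intro hm
      refine ih (hS.mem_degreeLE_of_coeffs_eq_zero hm fun v hv => ?_)
      refine hS.eq_zero_of_forall_mul_map_coeffs_eq_zero hsemiprime hGoldie
        (fun d hd h => hc d hd (hfc d h))
        (hS.topCoeffs_subset_topIdeal _ ⟨m + 1, g, hgJ, hm, v, hv, rfl⟩) v fun w hw => ?_
      have hlen : (v * w).length = m + 1 + n := by rw [FreeMonoid.length_mul, hv, hw]
      rw [← hS.coeffs_mul_mul hm hf hv hw, ← hgf, map_add, Finsupp.add_apply,
        hm _ (by omega), hf _ (by omega), add_zero]
  obtain ⟨m, hm⟩ := hS.exists_mem_degreeLE g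
  have hg0 := hS.eq_scalar_of_mem_degreeLE_zero (hg m hm)
  set b := hS.coeffs g 1
  -- `g = b` is a scalar, so `(1 - b) (1 - f) = 1` gives a right inverse of `1 - b` in `R`
  have hinv : (1 - b) * hS.coeffs (1 - f) 1 = 1 := by
    rw [← hS.coeffs_scalar_mul, map_sub i, map_one i, ← hg0]
    have : (1 - g) * (1 - f) = 1 := by
      have : (1 - g) * (1 - f) = 1 - (g + f) + g * f := by noncomm_ring
      rw [this, hgf]; abel
    rw [this, ← map_one i, hS.coeffs_scalar, Finsupp.single_eq_same]
  have hf0 : 1 - f = i (hS.coeffs (1 - f) 1) := by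
    have h1 : (1 - f) * (1 - g) = 1 := by
      have : (1 - f) * (1 - g) = 1 - (g + f) + f * g := by noncomm_ring
      rw [this, hfg]; abel
    have h2 := congrArg i hinv
    rw [map_mul, map_sub i, map_one i, ← hg0] at h2
    exact left_inv_eq_right_inv h1 h2
  -- hence `f` is a scalar, its coefficients in degree `n > 0` vanish, and so does `I`
  have hfs : f = i (1 - hS.coeffs (1 - f) 1) := by
    rw [map_sub, map_one, ← hf0, sub_sub_cancel]
  have hfw : ∀ w : FreeMonoid X, w.length = n → hS.coeffs f w = 0 := by
    intro w hw
    rw [hfs]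
    exact hS.scalar_mem_degreeLE _ 0 w (by omega)
  have hbot : I = ⊥ := by
    rw [eq_bot_iff]
    intro d hd
    exact hc d hd (hfc d fun w hw => by rw [hfw w hw, mul_zero])
  rw [IsSemiprimitiveRing, eq_bot_iff]
  exact fun s hs => hS.eq_zero_of_topIdeal_eq_bot hbot hs
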